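/- Let $m \ge 0$ be an integer and let $\{X_k\}_{k\in\mathbb Z}$ be i.i.d. real random variables with mean zero and variance one. Put $Y^{(m)}_j=\sum_{r=-m}^{m}X_{j+r}$ for $j\in\mathbb Z$. For $n\ge 1$ let $T_{n,m}$ be the $n\times n$ symmetric Toeplitz matrix whose $(i,j)$-th entry is $Y^{(m)}_{|j-i|}/\sqrt n$, and let $H_{n,m}$ be the $n\times n$ Hankel matrix whose $(i,j)$-th entry is $Y^{(m)}_{n-(i+j)+1}/\sqrt n$ $(1\le i,j\le n)$. The empirical spectral distribution of a real symmetric $n\times n$ matrix is the probability measure with mass $1/n$ at each of its eigenvalues, counted with multiplicity. Let $\mathcal L_{T,m}$ and $\mathcal L_{H,m}$ be the limiting spectral distributions of $T_{n,m}$ and $H_{n,m}$, that is, the non-random probability measures on $\mathbb R$ to which, almost surely, the empirical spectral distributions of $T_{n,m}$ and of $H_{n,m}$ converge weakly as $n\to\infty$. Then $\mathcal L_{T,m}$ and $\mathcal L_{H,m}$ both have unbounded support. -/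

import Mathlib

open MeasureTheory ProbabilityTheory Filter Topology
open scoped BoundedContinuousFunction ENNReal

noncomputable section

/-- The `n × n` symmetric Toeplitz matrix of a sequence `x`: its `(i, j)` entry is `x_{|j - i|}`. -/
def symToeplitz (n : ℕ) (x : ℤ → ℝ) : Matrix (Fin n) (Fin n) ℝ :=
  Matrix.of fun i j => x |((j : ℕ) : ℤ) - ((i : ℕ) : ℤ)|

/-- The `n × n` Hankel matrix of a two-sided sequence `x`: for row and column numbers `i, j` in
`1, …, n` its `(i, j)` entry is `x_{n - (i + j) + 1}`. (An index `i : Fin n` stands for the row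
number `i + 1`.) The top left entry is `x_{n-1}` and the bottom right entry is `x_{1-n}`. -/
def hankel (n : ℕ) (x : ℤ → ℝ) : Matrix (Fin n) (Fin n) ℝ :=
  Matrix.of fun i j =>
    x ((n : ℤ) - ((((i : ℕ) : ℤ) + 1) + (((j : ℕ) : ℤ) + 1)) + 1)

/-- The moving sum `Y_j = ∑_{r=-m}^{m} X_{j+r}`. -/
def movingSum (m : ℕ) (X : ℤ → ℝ) (j : ℤ) : ℝ :=
  ∑ r ∈ Finset.Icc (-(m : ℤ)) (m : ℤ), X (j + r)

/-- The symmetric Toeplitz matrix `T_{n,m}`, with entries `Y_j / √n`. -/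
def toeplitzMA (m n : ℕ) (X : ℤ → ℝ) : Matrix (Fin n) (Fin n) ℝ :=
  symToeplitz n fun j => movingSum m X j / Real.sqrt n

/-- The Hankel matrix `H_{n,m}`, with entries `Y_j / √n`. -/
def hankelMA (m n : ℕ) (X : ℤ → ℝ) : Matrix (Fin n) (Fin n) ℝ :=
  hankel n fun j => movingSum m X j / Real.sqrt n

theorem toeplitzMA_isHermitian (m n : ℕ) (X : ℤ → ℝ) : (toeplitzMA m n X).IsHermitian := by
  ext i j
  simp [toeplitzMA, symToeplitz, abs_sub_comm]

theorem hankelMA_isHermitian (m n : ℕ) (X : ℤ → ℝ) : (hankelMA m n X).IsHermitian := by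
  ext i j
  simp [hankelMA, hankel, add_comm]

/-- The empirical spectral distribution of a real symmetric `n × n` matrix: mass `1 / n` at each
eigenvalue, counted with multiplicity. -/
def esd {n : ℕ} (A : Matrix (Fin n) (Fin n) ℝ) (hA : A.IsHermitian) : Measure ℝ :=
  (n : ℝ≥0∞)⁻¹ • ∑ k : Fin n, Measure.dirac (hA.eigenvalues k)

/-- `L` is the limiting spectral distribution, almost surely, of the random real symmetric matrices
`A n`: for almost every `ω` the empirical spectral distributions of `A n ω` converge weakly to the
fixed (non-random) measure `L`. -/
def IsAlmostSureLSD {Ω : Type*} [MeasurableSpace Ω] (P : Measure Ω)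
    (A : (n : ℕ) → Ω → Matrix (Fin n) (Fin n) ℝ) (hA : ∀ n ω, (A n ω).IsHermitian)
    (L : Measure ℝ) : Prop :=
  ∀ᵐ ω ∂P, ∀ f : ℝ →ᵇ ℝ,
    Tendsto (fun n => ∫ x, f x ∂(esd (A n ω) (hA n ω))) atTop (𝓝 (∫ x, f x ∂L))

end

/-!
Neither limiting spectral distribution is computed here; the spectrum is tested against plane
waves. Let `A` be one of the two matrices, with eigenvalues `λ_k`. For a frequency `θ` let `w_k(θ)`
be the squared modulus of the `k`-th spectral coordinate of the unit vector `t ↦ exp (i t θ) / √n`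
(`waveWeight`). The weights sum to one over `k`, and each has integral `2 π / n` over a period.
The sesquilinear form of the Toeplitz matrix at this vector, and the real part of the bilinear form
of the Hankel matrix at it (after removal of a phase), are real numbers `g(θ)` with
`|g(θ)| ≤ ∑ |λ_k| w_k(θ)`. Hence the excess `(|g(θ)| - R)₊`, averaged over `θ`, is at most
the excess `(|x| - R)₊` integrated against the empirical spectral distribution
(`lintegral_excess_le_sum_eigenvalues`).

Suppose that the limit lives on `[-R, R]`. Truncate the excess at height `M`. The truncated part
tends to zero almost surely, and the remainder is at most `1 / M` times the normalized trace of the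
square of `A`, whose expectation is bounded in `n`. So the expected averaged excess of `g` has lower
limit zero (`liminf_lintegral_form_le`).

On the other hand `g(θ)` is a weighted sum of the variables `X_l`, with weights (`waveCoeff`) that
are uniformly `O(1 / √n)` and whose squares, for small `θ > 0`, sum to at least a positive constant
(`eventually_le_sum_waveCoeff_sq`). By a central limit theorem for weighted sums, which follows from
Lévy's continuity theorem, its expected excess over any level stays away from zero
(`exists_pos_le_lintegral_excess`), and by Fatou's lemma so does the average over `θ`
(`liminf_lintegral_form_pos`). This is a contradiction.
-/

/-! ### A central limit theorem for weighted sums -/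

section WeightedSum

theorem norm_prod_sub_prod_le_sum {ι : Type*} (s : Finset ι) (z w : ι → ℂ)
    (hz : ∀ i ∈ s, ‖z i‖ ≤ 1) (hw : ∀ i ∈ s, ‖w i‖ ≤ 1) :
    ‖∏ i ∈ s, z i - ∏ i ∈ s, w i‖ ≤ ∑ i ∈ s, ‖z i - w i‖ := by
  classical
  induction s using Finset.induction_on with
  | empty => simp
  | insert a s ha ih =>
    rw [Finset.prod_insert ha, Finset.prod_insert ha, Finset.sum_insert ha]
    have hz' : ∀ i ∈ s, ‖z i‖ ≤ 1 := fun i hi => hz i (Finset.mem_insert_of_mem hi)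
    have hw' : ∀ i ∈ s, ‖w i‖ ≤ 1 := fun i hi => hw i (Finset.mem_insert_of_mem hi)
    have h1 : ‖∏ i ∈ s, z i‖ ≤ 1 := by
      rw [norm_prod]
      exact Finset.prod_le_one (fun _ _ => norm_nonneg _) hz'
    have h2 : ‖w a‖ ≤ 1 := hw a (Finset.mem_insert_self _ _)
    calc ‖z a * ∏ i ∈ s, z i - w a * ∏ i ∈ s, w i‖
        = ‖(z a - w a) * ∏ i ∈ s, z i + w a * (∏ i ∈ s, z i - ∏ i ∈ s, w i)‖ := by
          congr 1; ring
      _ ≤ ‖z a - w a‖ * ‖∏ i ∈ s, z i‖ + ‖w a‖ * ‖∏ i ∈ s, z i - ∏ i ∈ s, w i‖ := by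
          refine (norm_add_le _ _).trans ?_
          rw [norm_mul, norm_mul]
      _ ≤ ‖z a - w a‖ * 1 + 1 * ∑ i ∈ s, ‖z i - w i‖ := by
          gcongr
          exact ih hz' hw'
      _ = _ := by ring

theorem exp_neg_sq_div_two_isLittleO :
    (fun t : ℝ => Complex.exp (-(t : ℂ) ^ 2 / 2) - (1 - (t : ℂ) ^ 2 / 2)) =o[𝓝 0]
      fun t : ℝ => t ^ 2 := by
  have h := (Complex.hasDerivAt_exp 0).isLittleO
  have ht : Tendsto (fun t : ℝ => -(t : ℂ) ^ 2 / 2) (𝓝 0) (𝓝 0) := by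
    have : Continuous (fun t : ℝ => -(t : ℂ) ^ 2 / 2) := by fun_prop
    simpa using this.tendsto 0
  have h2 := h.comp_tendsto ht
  have h3 : (fun t : ℝ => -(t : ℂ) ^ 2 / 2) =O[𝓝 0] fun t : ℝ => t ^ 2 := by
    refine Asymptotics.IsBigO.of_bound 1 (Eventually.of_forall fun t => ?_)
    rw [norm_div, norm_neg, norm_pow, norm_pow]
    simp
    nlinarith [sq_nonneg t]
  refine (h2.trans_isBigO ?_).congr_left ?_
  · simpa [Function.comp_def] using h3
  · intro t
    simp
    ring

variable {Ω : Type*} [MeasurableSpace Ω] {P : Measure Ω} [IsProbabilityMeasure P]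

theorem charFun_sub_exp_isLittleO {X : Ω → ℝ} (hX : AEMeasurable X P) (h0 : ∫ ω, X ω ∂P = 0)
    (h1 : ∫ ω, X ω ^ 2 ∂P = 1) :
    (fun t : ℝ => charFun (P.map X) t - Complex.exp (-(t : ℂ) ^ 2 / 2)) =o[𝓝 0]
      fun t : ℝ => t ^ 2 := by
  have h := taylor_charFun_two hX h0 (by simpa using h1)
  refine (h.sub exp_neg_sq_div_two_isLittleO).congr_left ?_
  intro t
  simp

/-- Lindeberg's condition is automatic for weighted sums of i.i.d. square integrable variables
once the largest weight tends to zero. -/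
theorem tendsto_charFun_weighted_sum {ι : Type*} {X : ι → Ω → ℝ} {Z : Ω → ℝ}
    (hindep : iIndepFun X P)
    (hident : ∀ k, IdentDistrib (X k) Z P P) (hmean : ∫ ω, Z ω ∂P = 0)
    (hvar : ∫ ω, Z ω ^ 2 ∂P = 1) (s : ℕ → Finset ι) (b : ℕ → ι → ℝ)
    (hsum : ∀ᶠ n in atTop, ∑ l ∈ s n, b n l ^ 2 = 1)
    (hsmall : ∀ ε > 0, ∀ᶠ n in atTop, ∀ l ∈ s n, |b n l| ≤ ε) (t : ℝ) :
    Tendsto (fun n => charFun (P.map fun ω => ∑ l ∈ s n, b n l * X l ω) t) atTop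
      (𝓝 (Complex.exp (-(t : ℂ) ^ 2 / 2))) := by
  have hprod : ∀ n, charFun (P.map fun ω => ∑ l ∈ s n, b n l * X l ω) t =
      ∏ l ∈ s n, charFun (P.map Z) (b n l * t) := by
    intro n
    have hi : iIndepFun (fun l ω => b n l * X l ω) P :=
      hindep.comp (fun l x => b n l * x) (fun l => by fun_prop)
    rw [(hi.restrict _).charFun_map_fun_finsetSum_eq_prod
      (fun l _ => ((hident l).aemeasurable_fst.const_mul _)), Finset.prod_apply]
    refine Finset.prod_congr rfl fun l _ => ?_
    rw [charFun_map_mul_comp (hident l).aemeasurable_fst, (hident l).map_eq]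
  simp_rw [hprod]
  rw [Metric.tendsto_atTop']
  intro ε hε
  have hη : 0 < ε / (2 * (t ^ 2 + 1)) := by positivity
  have ho := (charFun_sub_exp_isLittleO (P := P) (hident (Classical.choice
    (by
      obtain ⟨n, hn⟩ := hsum.exists
      by_contra hne
      have : s n = ∅ := by
        ext x; exact (hne ⟨x⟩).elim
      simp [this] at hn))).aemeasurable_snd hmean hvar).def hη
  obtain ⟨δ, hδ, hball⟩ := Metric.eventually_nhds_iff.1 ho
  have hev := hsum.and (hsmall (δ / (2 * (|t| + 1))) (by positivity))
  obtain ⟨N, hN⟩ := eventually_atTop.1 hev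
  refine ⟨N, fun n hn => ?_⟩
  obtain ⟨h1, h2⟩ := hN n hn.le
  have hexp : Complex.exp (-(t : ℂ) ^ 2 / 2) =
      ∏ l ∈ s n, Complex.exp (-((b n l * t : ℝ) : ℂ) ^ 2 / 2) := by
    rw [← Complex.exp_sum]
    congr 1
    have : (∑ l ∈ s n, (b n l : ℂ) ^ 2) = 1 := by exact_mod_cast h1
    push_cast
    rw [← Finset.sum_div, Finset.sum_neg_distrib]
    simp_rw [mul_pow]
    rw [← Finset.sum_mul, this, one_mul]
  rw [dist_eq_norm, hexp]
  have : IsProbabilityMeasure (P.map Z) := by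
    obtain ⟨n, hn⟩ := hsum.exists
    have hne : (s n).Nonempty := by
      by_contra hne
      simp [Finset.not_nonempty_iff_eq_empty.1 hne] at hn
    exact Measure.isProbabilityMeasure_map (hident hne.choose).aemeasurable_snd
  refine (norm_prod_sub_prod_le_sum _ _ _ (fun l _ => norm_charFun_le_one _) ?_).trans_lt ?_
  · intro l _
    rw [Complex.norm_exp]
    have : (-((b n l * t : ℝ) : ℂ) ^ 2 / 2).re = -(b n l * t) ^ 2 / 2 := by
      norm_cast
    rw [this, Real.exp_le_one_iff]
    nlinarith [sq_nonneg (b n l * t)]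
  · calc ∑ l ∈ s n, ‖charFun (P.map Z) (b n l * t) - Complex.exp (-((b n l * t : ℝ) : ℂ) ^ 2 / 2)‖
        ≤ ∑ l ∈ s n, ε / (2 * (t ^ 2 + 1)) * (b n l ^ 2 * t ^ 2) := by
          refine Finset.sum_le_sum fun l hl => ?_
          have hd : dist (b n l * t) 0 < δ := by
            rw [Real.dist_0_eq_abs, abs_mul]
            calc |b n l| * |t| ≤ δ / (2 * (|t| + 1)) * (|t| + 1) := by
                  gcongr
                  · exact h2 l hl
                  · linarith
              _ = δ / 2 := by field_simp
              _ < δ := by linarith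
          have := hball hd
          rwa [Real.norm_of_nonneg (sq_nonneg _), mul_pow] at this
      _ = ε / (2 * (t ^ 2 + 1)) * t ^ 2 := by
          rw [← Finset.mul_sum, ← Finset.sum_mul, h1, one_mul]
      _ ≤ ε / (2 * (t ^ 2 + 1)) * (t ^ 2 + 1) := by
          gcongr; linarith
      _ = ε / 2 := by field_simp
      _ < ε := by linarith

/-- The excess of `c * |x|` over `R`, truncated at height `M`: a bounded continuous test
function. -/
noncomputable def truncExcess (c R M : ℝ) : ℝ →ᵇ ℝ :=
  BoundedContinuousFunction.ofNormedAddCommGroup (fun x => max 0 (min (c * |x| - R) M))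
    (by fun_prop) |M| (by
      intro x
      rw [Real.norm_of_nonneg (le_max_left _ _)]
      exact max_le (abs_nonneg _) ((min_le_right _ _).trans (le_abs_self _)))

theorem truncExcess_apply (c R M x : ℝ) : truncExcess c R M x = max 0 (min (c * |x| - R) M) := rfl

theorem integral_truncExcess_gaussianReal_pos {c M : ℝ} (hc : 0 < c) (hM : 0 < M) (R : ℝ) :
    0 < ∫ x, truncExcess c R M x ∂(gaussianReal 0 1) := by
  have hnn : ∀ x, 0 ≤ truncExcess c R M x := fun x => le_max_left _ _
  rw [integral_pos_iff_support_of_nonneg hnn ((truncExcess c R M).integrable _)]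
  have hopen : IsOpen (Function.support (truncExcess c R M)) :=
    (truncExcess c R M).continuous.isOpen_support
  have hne : (Function.support (truncExcess c R M)).Nonempty := by
    refine ⟨(|R| + 1) / c, ?_⟩
    rw [Function.mem_support, truncExcess_apply]
    have : c * |(|R| + 1) / c| = |R| + 1 := by
      rw [abs_of_nonneg (by positivity)]; field_simp
    rw [this]
    refine ne_of_gt (lt_max_of_lt_right (lt_min ?_ hM))
    linarith [le_abs_self R]
  have hv := hopen.measure_pos volume hne
  have hac : (volume : Measure ℝ) ≪ gaussianReal 0 1 :=
    gaussianReal_absolutelyContinuous' 0 one_ne_zero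
  exact pos_iff_ne_zero.2 fun h => hv.ne' (hac h)

/-- Weighted sums of i.i.d. variables whose weights are uniformly small but whose variance stays
away from zero exceed any level `R` with a non-vanishing expected excess. The sums are rescaled to
variance one, so that their variances need not converge. -/
theorem exists_pos_le_lintegral_excess {ι : Type*} {X : ι → Ω → ℝ} {Z : Ω → ℝ}
    (hindep : iIndepFun X P)
    (hident : ∀ k, IdentDistrib (X k) Z P P) (hmean : ∫ ω, Z ω ∂P = 0)
    (hvar : ∫ ω, Z ω ^ 2 ∂P = 1) (s : ℕ → Finset ι) (a : ℕ → ι → ℝ) {c : ℝ} (hc : 0 < c)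
    (hsum : ∀ᶠ n in atTop, c ≤ ∑ l ∈ s n, a n l ^ 2)
    (hsmall : ∀ ε > 0, ∀ᶠ n in atTop, ∀ l ∈ s n, |a n l| ≤ ε) (R : ℝ) :
    0 < liminf (fun n => ∫⁻ ω, ENNReal.ofReal (|∑ l ∈ s n, a n l * X l ω| - R) ∂P) atTop := by
  set σ : ℕ → ℝ := fun n => √(∑ l ∈ s n, a n l ^ 2) with hσ
  have hσc : ∀ᶠ n in atTop, √c ≤ σ n := hsum.mono fun n hn => Real.sqrt_le_sqrt hn
  have hc' : 0 < √c := Real.sqrt_pos.2 hc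
  set b : ℕ → ι → ℝ := fun n l => a n l / σ n with hb
  set S : ℕ → Ω → ℝ := fun n ω => ∑ l ∈ s n, b n l * X l ω with hS
  have hSm : ∀ n, AEMeasurable (S n) P := fun n =>
    Finset.aemeasurable_fun_sum _ fun l _ => (hident l).aemeasurable_fst.const_mul _
  have hchar := tendsto_charFun_weighted_sum hindep hident hmean hvar s b
    (by
      filter_upwards [hσc, hsum] with n hn hn'
      have h2 : σ n ^ 2 = ∑ l ∈ s n, a n l ^ 2 := Real.sq_sqrt (hc.le.trans hn')
      simp_rw [hb, div_pow]
      rw [← Finset.sum_div, ← h2, div_self (pow_ne_zero _ (hc'.trans_le hn).ne')])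
    (by
      intro ε hε
      filter_upwards [hσc, hsmall (ε * √c) (by positivity)] with n hn h l hl
      have hpos := hc'.trans_le hn
      rw [hb, abs_div, abs_of_pos hpos, div_le_iff₀ hpos]
      exact (h l hl).trans (by gcongr))
  let μ : ℕ → ProbabilityMeasure ℝ := fun n =>
    ⟨P.map (S n), Measure.isProbabilityMeasure_map (hSm n)⟩
  let ν : ProbabilityMeasure ℝ := ⟨gaussianReal 0 1, inferInstance⟩
  have hlim : Tendsto μ atTop (𝓝 ν) := by
    refine ProbabilityMeasure.tendsto_iff_tendsto_charFun.2 fun t => ?_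
    simpa [μ, ν, charFun_gaussianReal, neg_div] using hchar t
  have hint := ProbabilityMeasure.tendsto_iff_forall_integral_tendsto.1 hlim (truncExcess (√c) R 1)
  have hpos : 0 < ∫ x, truncExcess (√c) R 1 x ∂(ν : Measure ℝ) :=
    integral_truncExcess_gaussianReal_pos hc' one_pos R
  set I := ∫ x, truncExcess (√c) R 1 x ∂(ν : Measure ℝ)
  have hev : ∀ᶠ n in atTop, ENNReal.ofReal (I / 2) ≤
      ∫⁻ ω, ENNReal.ofReal (|∑ l ∈ s n, a n l * X l ω| - R) ∂P := by
    filter_upwards [hint.eventually (lt_mem_nhds (half_lt_self hpos)), hσc] with n hn hn'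
    have hp := hc'.trans_le hn'
    have h1 : ∫ x, truncExcess (√c) R 1 x ∂(μ n : Measure ℝ) =
        ∫ ω, truncExcess (√c) R 1 (S n ω) ∂P := by
      change ∫ x, truncExcess (√c) R 1 x ∂(P.map (S n)) = _
      rw [integral_map (hSm n) (truncExcess (√c) R 1).continuous.aestronglyMeasurable]
    rw [h1] at hn
    refine (ENNReal.ofReal_le_ofReal hn.le).trans ?_
    refine (ofReal_integral_eq_lintegral_ofReal ?_ ?_).trans_le ?_
    · refine Integrable.of_bound (C := |1|) ?_ (Eventually.of_forall fun ω => ?_)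
      · exact ((truncExcess (√c) R 1).continuous.measurable.comp_aemeasurable
          (hSm n)).aestronglyMeasurable
      · rw [truncExcess_apply, Real.norm_of_nonneg (le_max_left _ _)]
        exact max_le (abs_nonneg _) ((min_le_right _ _).trans (le_abs_self _))
    · exact Eventually.of_forall fun ω => le_max_left _ _
    · refine lintegral_mono fun ω => ?_
      have hSa : ∑ l ∈ s n, a n l * X l ω = σ n * S n ω := by
        simp_rw [hS, hb, Finset.mul_sum]
        refine Finset.sum_congr rfl fun l _ => ?_
        field_simp
      have h3 : √c * |S n ω| ≤ |∑ l ∈ s n, a n l * X l ω| := by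
        rw [hSa, abs_mul, abs_of_pos hp]
        gcongr
      rw [truncExcess_apply, ENNReal.ofReal_le_iff_le_toReal ENNReal.ofReal_ne_top,
        ENNReal.toReal_ofReal']
      rw [max_comm (_ - _)]
      exact max_le_max le_rfl ((min_le_left _ _).trans (by linarith))
  exact lt_of_lt_of_le (ENNReal.ofReal_pos.2 (half_pos hpos))
    (le_liminf_of_le (by isBoundedDefault) hev)

end WeightedSum

/-! ### Spectral weights of plane waves -/

section SpectralWeight

variable {n : ℕ} {A : Matrix (Fin n) (Fin n) ℝ} (hA : A.IsHermitian)

theorem sum_eigenvectorUnitary_mul_row (i j : Fin n) :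
    ∑ k, hA.eigenvectorUnitary.1 i k * hA.eigenvectorUnitary.1 j k = if i = j then 1 else 0 := by
  have h := congrFun (congrFun (Unitary.coe_mul_star_self hA.eigenvectorUnitary) i) j
  simpa [Matrix.mul_apply, Matrix.one_apply, Matrix.star_apply] using h

theorem sum_eigenvectorUnitary_mul_col (k l : Fin n) :
    ∑ i, hA.eigenvectorUnitary.1 i k * hA.eigenvectorUnitary.1 i l = if k = l then 1 else 0 := by
  have h := congrFun (congrFun (Unitary.coe_star_mul_self hA.eigenvectorUnitary) k) l
  simpa [Matrix.mul_apply, Matrix.one_apply, Matrix.star_apply] using h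

theorem apply_eq_sum_eigenvalues (i j : Fin n) :
    A i j = ∑ k, hA.eigenvalues k *
      (hA.eigenvectorUnitary.1 i k * hA.eigenvectorUnitary.1 j k) := by
  have h := congrFun (congrFun hA.spectral_theorem i) j
  rw [Unitary.conjStarAlgAut_apply, Matrix.mul_apply] at h
  rw [h]
  refine Finset.sum_congr rfl fun k _ => ?_
  rw [Matrix.mul_diagonal]
  simp [Matrix.star_apply]
  ring

theorem sum_apply_mul_mul_eq (x : Fin n → ℝ) :
    ∑ i, ∑ j, A i j * (x i * x j) =
      ∑ k, hA.eigenvalues k * (∑ t, hA.eigenvectorUnitary.1 t k * x t) ^ 2 := by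
  simp_rw [apply_eq_sum_eigenvalues hA, sq, Finset.sum_mul_sum, Finset.sum_mul, Finset.mul_sum]
  rw [Finset.sum_congr rfl fun i _ => Finset.sum_comm, Finset.sum_comm]
  refine Finset.sum_congr rfl fun k _ => Finset.sum_congr rfl fun i _ =>
    Finset.sum_congr rfl fun j _ => ?_
  ring

theorem sum_sq_eigenvalues : ∑ k, hA.eigenvalues k ^ 2 = ∑ i, ∑ j, A i j ^ 2 := by
  have h : ∀ i j, A i j ^ 2 = ∑ k, hA.eigenvalues k *
      (A i j * (hA.eigenvectorUnitary.1 i k * hA.eigenvectorUnitary.1 j k)) := by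
    intro i j
    conv_lhs => rw [sq]; rhs; rw [apply_eq_sum_eigenvalues hA i j]
    rw [Finset.mul_sum]
    refine Finset.sum_congr rfl fun k _ => by ring
  simp_rw [h]
  rw [Finset.sum_congr rfl fun i _ => Finset.sum_comm, Finset.sum_comm]
  refine Finset.sum_congr rfl fun k _ => ?_
  simp_rw [← Finset.mul_sum]
  rw [sum_apply_mul_mul_eq hA, sq]
  congr 1
  rw [Finset.sum_congr rfl fun l _ => by rw [sum_eigenvectorUnitary_mul_col hA l k]]
  simp

/-- The squared modulus of the coordinate, along the `k`-th eigenvector of `A`, of the unit vector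
`t ↦ exp (i t θ) / √n`, written with real quantities only. -/
noncomputable def waveWeight (k : Fin n) (θ : ℝ) : ℝ :=
  ((∑ t : Fin n, hA.eigenvectorUnitary.1 t k * Real.cos (t * θ)) ^ 2 +
    (∑ t : Fin n, hA.eigenvectorUnitary.1 t k * Real.sin (t * θ)) ^ 2) / n

theorem waveWeight_nonneg (k : Fin n) (θ : ℝ) : 0 ≤ waveWeight hA k θ := by
  unfold waveWeight; positivity

theorem continuous_waveWeight (k : Fin n) : Continuous (waveWeight hA k) := by
  unfold waveWeight; fun_prop

/-- The weights do not depend on the phase of the plane wave. -/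
theorem waveWeight_eq_of_phase (k : Fin n) (θ α : ℝ) :
    waveWeight hA k θ =
      ((∑ t : Fin n, hA.eigenvectorUnitary.1 t k * Real.cos (t * θ + α)) ^ 2 +
        (∑ t : Fin n, hA.eigenvectorUnitary.1 t k * Real.sin (t * θ + α)) ^ 2) / n := by
  unfold waveWeight
  simp_rw [Real.cos_add, Real.sin_add, mul_sub, mul_add, ← mul_assoc, Finset.sum_sub_distrib,
    Finset.sum_add_distrib, ← Finset.sum_mul]
  congr 1
  have h := Real.sin_sq_add_cos_sq α
  set C := ∑ t : Fin n, hA.eigenvectorUnitary.1 t k * Real.cos (t * θ)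
  set S := ∑ t : Fin n, hA.eigenvectorUnitary.1 t k * Real.sin (t * θ)
  linear_combination (-(C ^ 2 + S ^ 2)) * h

theorem waveWeight_eq_sum (k : Fin n) (θ : ℝ) :
    waveWeight hA k θ = (∑ s : Fin n, ∑ t : Fin n,
      hA.eigenvectorUnitary.1 s k * hA.eigenvectorUnitary.1 t k *
        Real.cos (((s : ℝ) - t) * θ)) / n := by
  unfold waveWeight
  congr 1
  simp_rw [sq, Finset.sum_mul_sum, ← Finset.sum_add_distrib]
  refine Finset.sum_congr rfl fun s _ => Finset.sum_congr rfl fun t _ => ?_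
  rw [sub_mul, Real.cos_sub]
  ring

theorem sum_waveWeight (hn : 0 < n) (θ : ℝ) : ∑ k, waveWeight hA k θ = 1 := by
  simp_rw [waveWeight_eq_sum, ← Finset.sum_div]
  rw [Finset.sum_comm, Finset.sum_congr rfl fun s _ => Finset.sum_comm]
  simp_rw [← Finset.sum_mul, sum_eigenvectorUnitary_mul_row]
  have : (n : ℝ) ≠ 0 := by positivity
  simp [this]

theorem integral_cos_natCast_sub_mul (s t : ℕ) :
    ∫ θ in (0 : ℝ)..(2 * Real.pi), Real.cos (((s : ℝ) - t) * θ) =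
      if s = t then 2 * Real.pi else 0 := by
  split_ifs with h
  · simp [h]
  · have h' : (s : ℝ) - t ≠ 0 := sub_ne_zero.2 (by exact_mod_cast h)
    rw [intervalIntegral.integral_comp_mul_left (fun x => Real.cos x) h', integral_cos]
    have h2 : Real.sin (((s : ℝ) - t) * (2 * Real.pi)) = 0 := by
      have := Real.sin_add_int_mul_two_pi 0 (s - t)
      simpa using this
    simp only [mul_zero, h2, Real.sin_zero, sub_zero, smul_zero]

theorem integral_waveWeight (k : Fin n) :
    ∫ θ in (0 : ℝ)..(2 * Real.pi), waveWeight hA k θ = 2 * Real.pi / n := by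
  simp_rw [waveWeight_eq_sum]
  rw [intervalIntegral.integral_div, intervalIntegral.integral_finsetSum
    (fun s _ => Continuous.intervalIntegrable (by fun_prop) _ _)]
  congr 1
  have h1 : ∀ s : Fin n, ∫ θ in (0 : ℝ)..(2 * Real.pi), (∑ t : Fin n,
      hA.eigenvectorUnitary.1 s k * hA.eigenvectorUnitary.1 t k *
        Real.cos (((s : ℝ) - t) * θ)) =
      hA.eigenvectorUnitary.1 s k * hA.eigenvectorUnitary.1 s k * (2 * Real.pi) := by
    intro s
    rw [intervalIntegral.integral_finsetSum
      (fun t _ => Continuous.intervalIntegrable (by fun_prop) _ _)]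
    simp_rw [intervalIntegral.integral_const_mul, integral_cos_natCast_sub_mul, ← Fin.ext_iff]
    simp
  simp_rw [h1]
  rw [← Finset.sum_mul, sum_eigenvectorUnitary_mul_col]
  simp

theorem abs_sum_add_le_sum_abs_eigenvalues (x y : Fin n → ℝ) :
    |∑ i, ∑ j, A i j * (x i * x j + y i * y j)| ≤
      ∑ k, |hA.eigenvalues k| * ((∑ t, hA.eigenvectorUnitary.1 t k * x t) ^ 2 +
        (∑ t, hA.eigenvectorUnitary.1 t k * y t) ^ 2) := by
  simp_rw [mul_add, Finset.sum_add_distrib]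
  rw [sum_apply_mul_mul_eq hA, sum_apply_mul_mul_eq hA, ← Finset.sum_add_distrib,
    ← Finset.sum_add_distrib]
  refine (Finset.abs_sum_le_sum_abs _ _).trans (Finset.sum_le_sum fun k _ => ?_)
  rw [← mul_add, abs_mul, abs_of_nonneg (by positivity : (0 : ℝ) ≤ _ ^ 2 + _ ^ 2), mul_add]

theorem abs_sum_sub_le_sum_abs_eigenvalues (x y : Fin n → ℝ) :
    |∑ i, ∑ j, A i j * (x i * x j - y i * y j)| ≤
      ∑ k, |hA.eigenvalues k| * ((∑ t, hA.eigenvectorUnitary.1 t k * x t) ^ 2 +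
        (∑ t, hA.eigenvectorUnitary.1 t k * y t) ^ 2) := by
  simp_rw [mul_sub, Finset.sum_sub_distrib]
  rw [sum_apply_mul_mul_eq hA, sum_apply_mul_mul_eq hA, ← Finset.sum_sub_distrib]
  refine (Finset.abs_sum_le_sum_abs _ _).trans (Finset.sum_le_sum fun k _ => ?_)
  rw [← mul_sub, abs_mul]
  gcongr
  refine (abs_sub _ _).trans_eq ?_
  rw [abs_of_nonneg (sq_nonneg _), abs_of_nonneg (sq_nonneg _)]

/-- The left side is the modulus of the sesquilinear form of `A` at the unit plane wave of
frequency `θ`. -/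
theorem abs_sum_mul_cos_sub_le (θ : ℝ) :
    |(∑ i, ∑ j, A i j * Real.cos (((j : ℝ) - i) * θ)) / n| ≤
      ∑ k, |hA.eigenvalues k| * waveWeight hA k θ := by
  have h := abs_sum_add_le_sum_abs_eigenvalues hA (fun t => Real.cos (t * θ))
    (fun t => Real.sin (t * θ))
  have h1 : ∀ i j : Fin n, Real.cos (((j : ℝ) - i) * θ) =
      Real.cos (i * θ) * Real.cos (j * θ) + Real.sin (i * θ) * Real.sin (j * θ) := by
    intro i j; rw [sub_mul, Real.cos_sub]; ring
  simp_rw [h1, waveWeight, mul_div_assoc', ← Finset.sum_div]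
  rw [abs_div, Nat.abs_cast]
  gcongr

/-- The left side is the modulus of the real part of the bilinear (not sesquilinear) form of `A` at
the unit plane wave of frequency `θ`, centred so that the phase vanishes on the main
antidiagonal. -/
theorem abs_sum_mul_cos_rev_sub_le (θ : ℝ) :
    |(∑ i, ∑ j, A i j * Real.cos (((n : ℝ) - 1 - j - i) * θ)) / n| ≤
      ∑ k, |hA.eigenvalues k| * waveWeight hA k θ := by
  set α : ℝ := -((n : ℝ) - 1) * θ / 2 with hα
  have h := abs_sum_sub_le_sum_abs_eigenvalues hA (fun t => Real.cos (t * θ + α))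
    (fun t => Real.sin (t * θ + α))
  have h1 : ∀ i j : Fin n, Real.cos (((n : ℝ) - 1 - j - i) * θ) =
      Real.cos (i * θ + α) * Real.cos (j * θ + α) -
        Real.sin (i * θ + α) * Real.sin (j * θ + α) := by
    intro i j
    rw [← Real.cos_add, ← Real.cos_neg]
    congr 1
    rw [hα]; ring
  simp_rw [h1, waveWeight_eq_of_phase hA _ θ α, mul_div_assoc', ← Finset.sum_div]
  rw [abs_div, Nat.abs_cast]
  gcongr

/-- A Peierls type inequality: the excess over `R` of the form at plane waves, averaged over all
frequencies, is at most the average excess of the eigenvalues. -/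
theorem lintegral_excess_le_sum_eigenvalues (hn : 0 < n) {g : ℝ → ℝ}
    (hg : ∀ θ, |g θ| ≤ ∑ k, |hA.eigenvalues k| * waveWeight hA k θ) (R : ℝ) :
    ∫⁻ θ in Set.Ioc 0 (2 * Real.pi), ENNReal.ofReal (|g θ| - R) ≤
      ENNReal.ofReal (2 * Real.pi / n * ∑ k, max 0 (|hA.eigenvalues k| - R)) := by
  have h1 : ∀ θ, |g θ| - R ≤ ∑ k, max 0 (|hA.eigenvalues k| - R) * waveWeight hA k θ := by
    intro θ
    calc |g θ| - R ≤ ∑ k, |hA.eigenvalues k| * waveWeight hA k θ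
          - R * ∑ k, waveWeight hA k θ := by
          rw [sum_waveWeight hA hn, mul_one]; linarith [hg θ]
      _ = ∑ k, (|hA.eigenvalues k| - R) * waveWeight hA k θ := by
          rw [Finset.mul_sum, ← Finset.sum_sub_distrib]
          exact Finset.sum_congr rfl fun k _ => by ring
      _ ≤ _ := Finset.sum_le_sum fun k _ =>
          mul_le_mul_of_nonneg_right (le_max_right _ _) (waveWeight_nonneg hA k θ)
  have hcont : Continuous fun θ =>
      ∑ k, max 0 (|hA.eigenvalues k| - R) * waveWeight hA k θ :=
    continuous_finsetSum _ fun k _ => continuous_const.mul (continuous_waveWeight hA k)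
  have hle : (0 : ℝ) ≤ 2 * Real.pi := by positivity
  refine (lintegral_mono fun θ => ENNReal.ofReal_le_ofReal (h1 θ)).trans ?_
  rw [← ofReal_integral_eq_lintegral_ofReal]
  · rw [← intervalIntegral.integral_of_le hle, intervalIntegral.integral_finsetSum
      (fun k _ => ((continuous_waveWeight hA k).intervalIntegrable _ _).const_mul _)]
    simp_rw [intervalIntegral.integral_const_mul, integral_waveWeight]
    rw [← Finset.sum_mul, mul_comm]
  · exact (hcont.intervalIntegrable 0 (2 * Real.pi)).1
  · exact Eventually.of_forall fun θ => Finset.sum_nonneg fun k _ =>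
      mul_nonneg (le_max_left _ _) (waveWeight_nonneg hA k θ)

theorem integral_esd (f : ℝ →ᵇ ℝ) :
    ∫ x, f x ∂(esd A hA) = (n : ℝ)⁻¹ * ∑ k, f (hA.eigenvalues k) := by
  unfold esd
  rw [integral_smul_measure, integral_finsetSum_measure fun k _ => integrable_dirac (by simp)]
  simp

/-- The excess over `R` is at most its truncation at height `M` plus a second moment error. -/
theorem sum_excess_le {M : ℝ} (hM : 0 < M) {R : ℝ} (hR : 0 ≤ R) :
    (n : ℝ)⁻¹ * ∑ k, max 0 (|hA.eigenvalues k| - R) ≤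
      ∫ x, truncExcess 1 R M x ∂(esd A hA) + M⁻¹ * ((n : ℝ)⁻¹ * ∑ i, ∑ j, A i j ^ 2) := by
  rw [integral_esd, ← sum_sq_eigenvalues hA, mul_left_comm, ← mul_add]
  gcongr
  rw [Finset.mul_sum, ← Finset.sum_add_distrib]
  refine Finset.sum_le_sum fun k _ => ?_
  set x := hA.eigenvalues k
  rw [truncExcess_apply, one_mul]
  have hx : 0 ≤ M⁻¹ * x ^ 2 := by positivity
  rcases le_total (|x| - R) M with h | h
  · rw [min_eq_left h]; linarith
  · have h2 : |x| ≤ M⁻¹ * x ^ 2 := by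
      rw [inv_mul_eq_div, le_div_iff₀ hM, ← sq_abs, sq]
      gcongr; linarith
    refine max_le ?_ ?_
    · have := le_max_left 0 (min (|x| - R) M); linarith
    · have := le_max_left 0 (min (|x| - R) M); linarith

end SpectralWeight

/-! ### The forms as weighted sums of the underlying variables -/

theorem sum_fin_sub_eq (F : ℤ → ℝ) (n : ℕ) :
    ∑ i : Fin n, ∑ j : Fin n, F ((j : ℤ) - i) =
      n * F 0 + ∑ k ∈ Finset.range n, ((n : ℝ) - (k + 1)) * (F (k + 1) + F (-(k + 1))) := by
  simp_rw [fun i : Fin n => Fin.sum_univ_eq_sum_range (fun j => F ((j : ℤ) - i)) n]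
  rw [Fin.sum_univ_eq_sum_range (fun i => ∑ j ∈ Finset.range n, F ((j : ℤ) - (i : ℕ))) n]
  induction n with
  | zero => simp
  | succ n ih =>
    simp_rw [Finset.sum_range_succ, Finset.sum_add_distrib]
    rw [ih]
    have h1 : ∑ i ∈ Finset.range n, F ((n : ℤ) - i) = ∑ k ∈ Finset.range n, F (k + 1) := by
      rw [← Finset.sum_range_reflect]
      refine Finset.sum_congr rfl fun k hk => congrArg F ?_
      have := Finset.mem_range.1 hk
      omega
    have h2 : ∑ j ∈ Finset.range n, F ((j : ℤ) - n) = ∑ k ∈ Finset.range n, F (-(k + 1)) := by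
      rw [← Finset.sum_range_reflect]
      refine Finset.sum_congr rfl fun k hk => congrArg F ?_
      have := Finset.mem_range.1 hk
      omega
    have h3 : ∑ k ∈ Finset.range n, (((n + 1 : ℕ) : ℝ) - (k + 1)) * (F (k + 1) + F (-(k + 1))) =
        ∑ k ∈ Finset.range n, ((n : ℝ) - (k + 1)) * (F (k + 1) + F (-(k + 1))) +
          (∑ k ∈ Finset.range n, F (k + 1) + ∑ k ∈ Finset.range n, F (-(k + 1))) := by
      rw [← Finset.sum_add_distrib, ← Finset.sum_add_distrib]
      refine Finset.sum_congr rfl fun k _ => ?_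
      push_cast; ring
    rw [h1, h2, h3]
    push_cast
    simp
    ring

theorem sum_Icc_neg_self_eq (G : ℤ → ℝ) (n : ℕ) :
    ∑ k ∈ Finset.Icc (-(n : ℤ)) n, G k =
      G 0 + ∑ k ∈ Finset.range n, (G (k + 1) + G (-(k + 1))) := by
  induction n with
  | zero => simp
  | succ n ih =>
    have h : Finset.Icc (-((n + 1 : ℕ) : ℤ)) ((n + 1 : ℕ) : ℤ) =
        insert ((n : ℤ) + 1) (insert (-((n : ℤ) + 1)) (Finset.Icc (-(n : ℤ)) n)) := by
      ext x; simp only [Finset.mem_Icc, Finset.mem_insert]; push_cast; omega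
    rw [h, Finset.sum_insert (by simp only [Finset.mem_Icc, Finset.mem_insert]; omega),
      Finset.sum_insert (by simp only [Finset.mem_Icc]; omega), ih, Finset.sum_range_succ]
    ring

/-- The weight of `Y_k` in the form of an `n × n` matrix at the plane wave of frequency `θ`:
`n - |k|` counts the positions on the `k`-th diagonal, and `c k` is the multiplicity with which
the matrix uses `Y_k` there. -/
noncomputable def diagWeight (c : ℤ → ℝ) (n : ℕ) (θ : ℝ) (k : ℤ) : ℝ :=
  c k * max ((n : ℝ) - |(k : ℝ)|) 0 * Real.cos (k * θ) / (n * √n)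

/-- The weight of `X_l` in the form of an `n × n` matrix at the plane wave of frequency `θ`. -/
noncomputable def waveCoeff (c : ℤ → ℝ) (m n : ℕ) (θ : ℝ) (l : ℤ) : ℝ :=
  ∑ r ∈ Finset.Icc (-(m : ℤ)) m, diagWeight c n θ (l - r)

theorem continuous_waveCoeff (c : ℤ → ℝ) (m n : ℕ) (l : ℤ) :
    Continuous fun θ => waveCoeff c m n θ l := by
  unfold waveCoeff diagWeight; fun_prop

theorem sum_waveCoeff_mul (c : ℤ → ℝ) (m n : ℕ) (θ : ℝ) (x : ℤ → ℝ) :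
    ∑ l ∈ Finset.Icc (-((n : ℤ) + m)) (n + m), waveCoeff c m n θ l * x l =
      ∑ k ∈ Finset.Icc (-(n : ℤ)) n, diagWeight c n θ k * movingSum m x k := by
  simp_rw [waveCoeff, movingSum, Finset.sum_mul, Finset.mul_sum]
  rw [Finset.sum_comm]
  conv_rhs => rw [Finset.sum_comm]
  refine Finset.sum_congr rfl fun r hr => ?_
  rw [Finset.mem_Icc] at hr
  symm
  refine Finset.sum_of_injOn (fun k => k + r) (fun a _ b _ h => by simpa using h) ?_ ?_ ?_
  · intro k hk
    simp only [Finset.coe_Icc, Set.mem_Icc] at hk ⊢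
    omega
  · intro l _ hl
    have : ¬ (-(n : ℤ) ≤ l - r ∧ l - r ≤ n) := by
      intro h
      exact hl ⟨l - r, by simpa using h, by simp⟩
    have h2 : (n : ℤ) ≤ |l - r| := by
      by_contra hlt
      rw [not_le, abs_lt] at hlt
      exact this ⟨hlt.1.le, hlt.2.le⟩
    have h3 : (n : ℝ) ≤ |((l - r : ℤ) : ℝ)| := by exact_mod_cast h2
    rw [diagWeight, max_eq_right (by linarith)]
    simp
  · intro k _
    simp

theorem abs_diagWeight_le {c : ℤ → ℝ} (hc : ∀ k, |c k| ≤ 2) {n : ℕ} (hn : 0 < n) (θ : ℝ)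
    (k : ℤ) : |diagWeight c n θ k| ≤ 2 / √n := by
  have hn' : (0 : ℝ) < n := by exact_mod_cast hn
  have h1 : |max ((n : ℝ) - |(k : ℝ)|) 0| ≤ n := by
    rw [abs_of_nonneg (le_max_right _ _)]
    exact max_le (by linarith [abs_nonneg (k : ℝ)]) hn'.le
  rw [diagWeight, abs_div, abs_mul, abs_mul, abs_of_pos (by positivity : 0 < (n : ℝ) * √n)]
  calc |c k| * |max ((n : ℝ) - |(k : ℝ)|) 0| * |Real.cos (k * θ)| / (n * √n)
      ≤ 2 * n * 1 / (n * √n) := by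
        gcongr
        · exact hc k
        · exact Real.abs_cos_le_one _
    _ = 2 / √n := by field_simp

theorem card_Icc_neg_self (m : ℕ) : ((Finset.Icc (-(m : ℤ)) m).card : ℝ) = 2 * m + 1 := by
  have : (Finset.Icc (-(m : ℤ)) m).card = 2 * m + 1 := by
    rw [Int.card_Icc]; omega
  rw [this]; push_cast; ring

theorem abs_waveCoeff_le {c : ℤ → ℝ} (hc : ∀ k, |c k| ≤ 2) (m : ℕ) {n : ℕ} (hn : 0 < n) (θ : ℝ)
    (l : ℤ) : |waveCoeff c m n θ l| ≤ (2 * m + 1) * (2 / √n) := by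
  refine (Finset.abs_sum_le_sum_abs _ _).trans ?_
  refine (Finset.sum_le_card_nsmul _ _ _ fun r _ => abs_diagWeight_le hc hn θ _).trans_eq ?_
  rw [nsmul_eq_mul, card_Icc_neg_self]

theorem eventually_abs_waveCoeff_le {c : ℤ → ℝ} (hc : ∀ k, |c k| ≤ 2) (m : ℕ) (θ : ℝ) {ε : ℝ}
    (hε : 0 < ε) : ∀ᶠ n : ℕ in atTop, ∀ l, |waveCoeff c m n θ l| ≤ ε := by
  have h : Tendsto (fun n : ℕ => (2 * (m : ℝ) + 1) * (2 / √n)) atTop (𝓝 0) := by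
    have := ((Real.tendsto_sqrt_atTop.comp tendsto_natCast_atTop_atTop).const_div_atTop
      (2 : ℝ)).const_mul (2 * (m : ℝ) + 1)
    simpa using this
  filter_upwards [h.eventually (ge_mem_nhds hε), eventually_gt_atTop 0] with n h1 h2 l
  exact (abs_waveCoeff_le hc m h2 θ l).trans h1

theorem one_sub_cos_le_cos_sq_add (a : ℝ) {θ : ℝ} (hθ : 0 ≤ Real.cos θ) :
    1 - Real.cos θ ≤ Real.cos a ^ 2 + Real.cos (a + θ) ^ 2 := by
  have h : Real.cos a ^ 2 + Real.cos (a + θ) ^ 2 = 1 + Real.cos (2 * a + θ) * Real.cos θ := by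
    have e1 : 2 * a + θ = a + (a + θ) := by ring
    have e2 : Real.cos θ = Real.cos ((a + θ) - a) := by congr 1; ring
    rw [e1, e2, Real.cos_add a (a + θ), Real.cos_sub]
    have h1 := Real.sin_sq_add_cos_sq a
    have h2 := Real.sin_sq_add_cos_sq (a + θ)
    linear_combination Real.sin (a + θ) ^ 2 * h1 + (1 - Real.cos a ^ 2) * h2
  rw [h]
  nlinarith [Real.neg_one_le_cos (2 * a + θ)]

theorem le_sum_range_cos_sq (m N : ℕ) {θ : ℝ} (hθ : 0 ≤ Real.cos θ) :
    N * (1 - Real.cos θ) ≤ ∑ i ∈ Finset.range (2 * N), Real.cos (((m : ℝ) + 1 + i) * θ) ^ 2 := by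
  induction N with
  | zero => simp
  | succ N ih =>
    rw [show 2 * (N + 1) = 2 * N + 1 + 1 by ring, Finset.sum_range_succ, Finset.sum_range_succ]
    have h := one_sub_cos_le_cos_sq_add (((m : ℝ) + 1 + (2 * N : ℕ)) * θ) hθ
    have e : ((m : ℝ) + 1 + (2 * N : ℕ)) * θ + θ = ((m : ℝ) + 1 + (2 * N + 1 : ℕ)) * θ := by
      push_cast; ring
    rw [e] at h
    push_cast at h ih ⊢
    linarith

/-- The Dirichlet kernel is at least one near the origin: all its terms are nonnegative. -/
theorem one_le_sum_cos {m : ℕ} {θ : ℝ} (h0 : 0 < θ) (h1 : θ ≤ 1 / (m + 1)) :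
    1 ≤ ∑ r ∈ Finset.Icc (-(m : ℤ)) m, Real.cos (r * θ) := by
  have hnn : ∀ r ∈ Finset.Icc (-(m : ℤ)) m, 0 ≤ Real.cos (r * θ) := by
    intro r hr
    rw [Finset.mem_Icc, ← abs_le] at hr
    have hr' : |(r : ℝ)| ≤ m := by exact_mod_cast hr
    have hle : |(r : ℝ) * θ| ≤ 1 := by
      rw [abs_mul, abs_of_pos h0]
      rw [le_div_iff₀ (by positivity)] at h1
      nlinarith [abs_nonneg (r : ℝ)]
    refine Real.cos_nonneg_of_mem_Icc ⟨?_, ?_⟩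
    · linarith [(abs_le.1 hle).1, Real.two_le_pi]
    · linarith [(abs_le.1 hle).2, Real.two_le_pi]
  have := Finset.single_le_sum hnn (a := 0) (by simp)
  simpa using this

theorem sum_sin_Icc_neg_self (m : ℕ) (θ : ℝ) :
    ∑ r ∈ Finset.Icc (-(m : ℤ)) m, Real.sin (r * θ) = 0 := by
  rw [sum_Icc_neg_self_eq (fun r => Real.sin (r * θ))]
  push_cast
  simp only [zero_mul, Real.sin_zero, zero_add]
  refine Finset.sum_eq_zero fun k _ => ?_
  rw [neg_mul, Real.sin_neg, add_neg_cancel]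

/-- In the bulk `m < l ≤ n / 2` the coefficient is a multiple, at least one, of
`(n - l) D cos (l θ)` with the Dirichlet kernel `D`, up to an error bounded in `n`. -/
theorem le_waveCoeff_sq {c : ℤ → ℝ} {c₁ : ℝ} (hc₁ : 1 ≤ c₁) (hc : ∀ k, 0 < k → c k = c₁) {m n : ℕ}
    {θ : ℝ} (h0 : 0 < θ) (h1 : θ ≤ 1 / (m + 1)) {l : ℕ} (hml : m < l) (hln : l + m ≤ n)
    (hl2 : 2 * l ≤ n) :
    Real.cos (l * θ) ^ 2 / (8 * n) - ((2 * m + 1) * m) ^ 2 / (n : ℝ) ^ 3 ≤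
      waveCoeff c m n θ l ^ 2 := by
  have hn : (0 : ℝ) < n := by exact_mod_cast (by omega : 0 < n)
  set D := ∑ r ∈ Finset.Icc (-(m : ℤ)) m, Real.cos (r * θ) with hD
  have hD1 : 1 ≤ D := one_le_sum_cos h0 h1
  set E := ∑ r ∈ Finset.Icc (-(m : ℤ)) m, (r : ℝ) * Real.cos ((l - r) * θ) with hE
  have hEle : |E| ≤ (2 * m + 1) * m := by
    refine (Finset.abs_sum_le_sum_abs _ _).trans ?_
    refine (Finset.sum_le_card_nsmul _ _ (m : ℝ) fun r hr => ?_).trans_eq ?_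
    · rw [Finset.mem_Icc, ← abs_le] at hr
      have hr' : |(r : ℝ)| ≤ m := by exact_mod_cast hr
      rw [abs_mul]
      exact (mul_le_of_le_one_right (abs_nonneg _) (Real.abs_cos_le_one _)).trans hr'
    · rw [nsmul_eq_mul, card_Icc_neg_self]
  have hcoef : waveCoeff c m n θ l = c₁ * (((n : ℝ) - l) * Real.cos (l * θ) * D + E) / (n * √n) := by
    have hS := sum_sin_Icc_neg_self m θ
    have hexp : ((n : ℝ) - l) * Real.cos (l * θ) * D + E =
        ∑ r ∈ Finset.Icc (-(m : ℤ)) m, ((n : ℝ) - l + r) * Real.cos ((l - r) * θ) := by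
      have : ((n : ℝ) - l) * Real.cos (l * θ) * D + E = ((n : ℝ) - l) * Real.cos (l * θ) * D +
          ((n : ℝ) - l) * Real.sin (l * θ) * ∑ r ∈ Finset.Icc (-(m : ℤ)) m, Real.sin (r * θ)
          + E := by rw [hS]; ring
      rw [this, hD, hE, Finset.mul_sum, Finset.mul_sum, ← Finset.sum_add_distrib,
        ← Finset.sum_add_distrib]
      refine Finset.sum_congr rfl fun r _ => ?_
      rw [sub_mul (l : ℝ), Real.cos_sub]
      ring
    rw [hexp, waveCoeff, Finset.mul_sum, Finset.sum_div]
    refine Finset.sum_congr rfl fun r hr => ?_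
    rw [Finset.mem_Icc] at hr
    have hpos : (0 : ℤ) < l - r := by omega
    have hpos' : (0 : ℝ) < ((l - r : ℤ) : ℝ) := by exact_mod_cast hpos
    have hle' : ((l - r : ℤ) : ℝ) ≤ n := by exact_mod_cast (by omega : (l : ℤ) - r ≤ n)
    rw [diagWeight, hc _ hpos, abs_of_pos hpos', max_eq_left (by linarith)]
    push_cast
    ring
  have hsq : (n * √n : ℝ) ^ 2 = (n : ℝ) ^ 3 := by
    rw [mul_pow, Real.sq_sqrt hn.le]; ring
  rw [hcoef, div_pow, hsq]
  set C := Real.cos (l * θ)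
  have hl2' : (n : ℝ) / 2 ≤ (n : ℝ) - l := by
    have : 2 * (l : ℝ) ≤ n := by exact_mod_cast hl2
    linarith
  have hu : ((n : ℝ) / 2) ^ 2 * C ^ 2 ≤ (((n : ℝ) - l) * C * D) ^ 2 := by
    rw [mul_pow, mul_pow]
    have h2 : ((n : ℝ) / 2) ^ 2 ≤ ((n : ℝ) - l) ^ 2 := by gcongr
    have h3 : 1 ≤ D ^ 2 := one_le_pow₀ hD1
    calc ((n : ℝ) / 2) ^ 2 * C ^ 2 ≤ ((n : ℝ) - l) ^ 2 * C ^ 2 * 1 := by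
          rw [mul_one]; gcongr
      _ ≤ _ := by gcongr
  have hE2 : E ^ 2 ≤ ((2 * m + 1) * m : ℝ) ^ 2 := by
    rw [← sq_abs]; gcongr
  set u := ((n : ℝ) - l) * C * D
  have hc2 : 1 ≤ c₁ ^ 2 := one_le_pow₀ hc₁
  have hmain : (n : ℝ) ^ 2 * C ^ 2 / 8 - ((2 * m + 1) * m : ℝ) ^ 2 ≤ (c₁ * (u + E)) ^ 2 := by
    have h4 : (u + E) ^ 2 ≤ (c₁ * (u + E)) ^ 2 := by
      rw [mul_pow]; exact le_mul_of_one_le_left (sq_nonneg _) hc2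
    nlinarith [sq_nonneg (u + 2 * E)]
  rw [le_div_iff₀ (by positivity)]
  refine le_trans (le_of_eq ?_) hmain
  field_simp

/-- The variance of the form is bounded below by the bulk indices `m < l ≤ m + 2 ⌊n / 8⌋`. They are
taken in consecutive pairs, as two neighbouring cosines cannot both be small. -/
theorem eventually_le_sum_waveCoeff_sq {c : ℤ → ℝ} {c₁ : ℝ} (hc₁ : 1 ≤ c₁)
    (hc : ∀ k, 0 < k → c k = c₁) (m : ℕ) {θ : ℝ} (h0 : 0 < θ) (h1 : θ ≤ 1 / (m + 1)) :
    ∀ᶠ n : ℕ in atTop, (1 - Real.cos θ) / 256 ≤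
      ∑ l ∈ Finset.Icc (-((n : ℤ) + m)) (n + m), waveCoeff c m n θ l ^ 2 := by
  have hθ1 : θ ≤ 1 := h1.trans (by rw [div_le_one (by positivity)]; linarith [m.cast_nonneg (α := ℝ)])
  have hcos : 0 ≤ Real.cos θ :=
    Real.cos_nonneg_of_mem_Icc ⟨by linarith [Real.two_le_pi], by linarith [Real.two_le_pi]⟩
  have hcos1 : Real.cos θ < 1 := by
    have := Real.cos_lt_cos_of_nonneg_of_le_pi le_rfl (by linarith [Real.two_le_pi]) h0
    simpa using this
  set K : ℝ := ((2 * m + 1) * m) ^ 2 with hK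
  have hlim : Tendsto (fun n : ℕ => K / (n : ℝ)) atTop (𝓝 0) :=
    tendsto_const_div_atTop_nhds_zero_nat K
  have hpos : 0 < (1 - Real.cos θ) / 256 := by linarith
  filter_upwards [hlim.eventually (ge_mem_nhds hpos), eventually_ge_atTop (16 * (m + 1))]
    with n hKn hn
  have hn0 : (1 : ℝ) ≤ n := by exact_mod_cast (by omega : 1 ≤ n)
  have hN : (n : ℝ) / 16 ≤ (n / 8 : ℕ) := by
    have : n ≤ 16 * (n / 8) := by omega
    have : (n : ℝ) ≤ 16 * (n / 8 : ℕ) := by exact_mod_cast this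
    linarith
  have hN2 : 2 * ((n / 8 : ℕ) : ℝ) ≤ n := by
    have : 2 * (n / 8) ≤ n := by omega
    exact_mod_cast this
  set N := n / 8
  have hle : ∑ i ∈ Finset.range (2 * N), waveCoeff c m n θ ((m + 1 + i : ℕ) : ℤ) ^ 2 ≤
      ∑ l ∈ Finset.Icc (-((n : ℤ) + m)) (n + m), waveCoeff c m n θ l ^ 2 := by
    rw [← Finset.sum_image (s := Finset.range (2 * N)) (g := fun i : ℕ => ((m + 1 + i : ℕ) : ℤ))
      (f := fun l => waveCoeff c m n θ l ^ 2) (fun a _ b _ h => by simpa using h)]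
    refine Finset.sum_le_sum_of_subset_of_nonneg ?_ fun _ _ _ => sq_nonneg _
    intro l hl
    obtain ⟨i, hi, rfl⟩ := Finset.mem_image.1 hl
    have := Finset.mem_range.1 hi
    rw [Finset.mem_Icc]
    omega
  refine le_trans ?_ hle
  have hterm : ∀ i ∈ Finset.range (2 * N),
      Real.cos (((m : ℝ) + 1 + i) * θ) ^ 2 / (8 * n) - K / (n : ℝ) ^ 3 ≤
        waveCoeff c m n θ ((m + 1 + i : ℕ) : ℤ) ^ 2 := by
    intro i hi
    have := Finset.mem_range.1 hi
    have h := le_waveCoeff_sq hc₁ hc (n := n) (l := m + 1 + i) h0 h1 (by omega) (by omega) (by omega)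
    push_cast at h ⊢
    exact h
  refine le_trans ?_ (Finset.sum_le_sum hterm)
  rw [Finset.sum_sub_distrib, ← Finset.sum_div]
  have h2 := le_sum_range_cos_sq m N hcos
  have h3 : (1 - Real.cos θ) / 128 ≤
      (∑ i ∈ Finset.range (2 * N), Real.cos (((m : ℝ) + 1 + i) * θ) ^ 2) / (8 * n) := by
    rw [le_div_iff₀ (by positivity)]
    nlinarith
  have h4 : ∑ _i ∈ Finset.range (2 * N), K / (n : ℝ) ^ 3 ≤ K / n := by
    rw [Finset.sum_const, Finset.card_range, nsmul_eq_mul]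
    have hK0 : 0 ≤ K := sq_nonneg _
    calc ((2 * N : ℕ) : ℝ) * (K / (n : ℝ) ^ 3) ≤ n * (K / (n : ℝ) ^ 2 ) := by
          push_cast
          gcongr
          · norm_num
      _ = K / n := by field_simp
  linarith

/-! ### The two forms at plane waves -/

/-- The multiplicity of `Y_k` on the `k`-th diagonals of the symmetric Toeplitz matrix: the
diagonals `k` and `-k` both carry `Y_{|k|}`, and both are counted at `|k|`. -/
noncomputable def toeplitzMult (k : ℤ) : ℝ := if k < 0 then 0 else if k = 0 then 1 else 2

theorem sum_symToeplitz_mul_cos (n : ℕ) (y : ℤ → ℝ) (θ : ℝ) :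
    (∑ i : Fin n, ∑ j : Fin n, symToeplitz n (fun k => y k / √n) i j *
        Real.cos (((j : ℝ) - i) * θ)) / n =
      ∑ k ∈ Finset.Icc (-(n : ℤ)) n, diagWeight toeplitzMult n θ k * y k := by
  rcases Nat.eq_zero_or_pos n with rfl | hn
  · simp [diagWeight]
  have hn' : (n : ℝ) ≠ 0 := by positivity
  have h := sum_fin_sub_eq (fun k => y |k| / √n * Real.cos (k * θ)) n
  push_cast at h
  simp only [symToeplitz, Matrix.of_apply]
  rw [h, sum_Icc_neg_self_eq, add_div, Finset.sum_div]
  congr 1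
  · simp [diagWeight, toeplitzMult]
    field_simp
  · refine Finset.sum_congr rfl fun k hk => ?_
    have hk' : (k : ℝ) + 1 ≤ n := by exact_mod_cast Finset.mem_range.1 hk
    have e1 : |(k : ℤ) + 1| = k + 1 := abs_of_pos (by omega)
    have e2 : |-((k : ℤ) + 1)| = k + 1 := by rw [abs_neg, e1]
    have e3 : |(k : ℝ) + 1| = k + 1 := abs_of_pos (by positivity)
    have c1 : toeplitzMult ((k : ℤ) + 1) = 2 := by
      rw [toeplitzMult, if_neg (by omega), if_neg (by omega)]
    have c2 : toeplitzMult (-((k : ℤ) + 1)) = 0 := by rw [toeplitzMult, if_pos (by omega)]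
    rw [e1, e2, diagWeight, diagWeight, c1, c2]
    push_cast
    rw [e3, max_eq_left (by linarith), neg_mul, Real.cos_neg]
    field_simp
    ring

theorem sum_hankel_mul_cos (n : ℕ) (y : ℤ → ℝ) (θ : ℝ) :
    (∑ i : Fin n, ∑ j : Fin n, hankel n (fun k => y k / √n) i j *
        Real.cos (((n : ℝ) - 1 - j - i) * θ)) / n =
      ∑ k ∈ Finset.Icc (-(n : ℤ)) n, diagWeight (fun _ => 1) n θ k * y k := by
  rcases Nat.eq_zero_or_pos n with rfl | hn
  · simp [diagWeight]
  have hn' : (n : ℝ) ≠ 0 := by positivity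
  have h := sum_fin_sub_eq (fun k => y k / √n * Real.cos (k * θ)) n
  push_cast at h
  have hrev : ∀ i : Fin n, ∑ j : Fin n, hankel n (fun k => y k / √n) i j *
        Real.cos (((n : ℝ) - 1 - j - i) * θ) =
      ∑ j : Fin n, y ((j : ℤ) - i) / √n * Real.cos (((j : ℝ) - i) * θ) := by
    intro i
    -- Reversing the order of the columns turns the Hankel matrix into a Toeplitz matrix.
    rw [← Equiv.sum_comp Fin.revPerm]
    refine Finset.sum_congr rfl fun j _ => ?_
    have e : ((Fin.rev j : Fin n) : ℕ) + (j + 1) = n := by rw [Fin.val_rev]; omega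
    have e1 : (n : ℤ) - ((((i : ℕ) : ℤ) + 1) + ((((Fin.rev j : Fin n) : ℕ) : ℤ) + 1)) + 1 =
        (j : ℤ) - i := by omega
    have e2 : (n : ℝ) - 1 - ((Fin.rev j : Fin n) : ℕ) = j := by
      have : (((Fin.rev j : Fin n) : ℕ) : ℝ) + (j + 1) = n := by exact_mod_cast e
      linarith
    simp only [hankel, Matrix.of_apply, Fin.revPerm_apply]
    rw [e1, e2]
  simp_rw [hrev]
  rw [h, sum_Icc_neg_self_eq, add_div, Finset.sum_div]
  congr 1
  · simp [diagWeight]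
    field_simp
  · refine Finset.sum_congr rfl fun k hk => ?_
    have hk' : (k : ℝ) + 1 ≤ n := by exact_mod_cast Finset.mem_range.1 hk
    have e3 : |(k : ℝ) + 1| = k + 1 := abs_of_pos (by positivity)
    rw [diagWeight, diagWeight]
    push_cast
    rw [abs_neg, e3, max_eq_left (by linarith), neg_mul, Real.cos_neg]
    field_simp

/-! ### Unboundedness of the support -/

section Support

variable {Ω : Type*} [MeasurableSpace Ω] {P : Measure Ω} {X : ℤ → Ω → ℝ}

theorem lintegral_movingSum_sq_le (m : ℕ) (hmeas : ∀ k, Measurable (X k))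
    (hsq : ∀ k, ∫⁻ ω, ENNReal.ofReal (X k ω ^ 2) ∂P = 1) (j : ℤ) :
    ∫⁻ ω, ENNReal.ofReal (movingSum m (fun k => X k ω) j ^ 2) ∂P ≤
      ENNReal.ofReal ((2 * m + 1) ^ 2) := by
  have h1 : ∀ ω, ENNReal.ofReal (movingSum m (fun k => X k ω) j ^ 2) ≤
      ENNReal.ofReal (2 * m + 1) *
        ∑ r ∈ Finset.Icc (-(m : ℤ)) m, ENNReal.ofReal (X (j + r) ω ^ 2) := by
    intro ω
    rw [← ENNReal.ofReal_sum_of_nonneg (fun _ _ => sq_nonneg _),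
      ← ENNReal.ofReal_mul (by positivity), ← card_Icc_neg_self]
    exact ENNReal.ofReal_le_ofReal sq_sum_le_card_mul_sum_sq
  refine (lintegral_mono h1).trans ?_
  rw [lintegral_const_mul' _ _ ENNReal.ofReal_ne_top, lintegral_finsetSum _ fun r _ => by
    have := hmeas (j + r); fun_prop]
  simp_rw [hsq]
  rw [Finset.sum_const, nsmul_one, ← ENNReal.ofReal_natCast, card_Icc_neg_self,
    ← ENNReal.ofReal_mul (by positivity), sq]

theorem lintegral_ofReal_mean_sq_le {n : ℕ} (hn : 0 < n) {a : Fin n → Fin n → Ω → ℝ}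
    (ha : ∀ i j, Measurable (a i j)) {K : ℝ}
    (h : ∀ i j, ∫⁻ ω, ENNReal.ofReal (a i j ω ^ 2) ∂P ≤ ENNReal.ofReal ((n : ℝ)⁻¹ * K)) :
    ∫⁻ ω, ENNReal.ofReal ((n : ℝ)⁻¹ * ∑ i, ∑ j, a i j ω ^ 2) ∂P ≤ ENNReal.ofReal K := by
  have hn' : (0 : ℝ) < n := by exact_mod_cast hn
  have hexp : ∀ ω, ENNReal.ofReal ((n : ℝ)⁻¹ * ∑ i, ∑ j, a i j ω ^ 2) =
      ENNReal.ofReal (n : ℝ)⁻¹ * ∑ i, ∑ j, ENNReal.ofReal (a i j ω ^ 2) := by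
    intro ω
    rw [ENNReal.ofReal_mul (by positivity), ENNReal.ofReal_sum_of_nonneg
      fun i _ => Finset.sum_nonneg fun j _ => sq_nonneg _]
    congr 1
    exact Finset.sum_congr rfl fun i _ => ENNReal.ofReal_sum_of_nonneg fun j _ => sq_nonneg _
  have hm : ∀ i j, Measurable fun ω => ENNReal.ofReal (a i j ω ^ 2) := fun i j => by fun_prop
  simp_rw [hexp]
  rw [lintegral_const_mul' _ _ ENNReal.ofReal_ne_top,
    lintegral_finsetSum _ fun i _ => Finset.measurable_fun_sum _ fun j _ => hm i j]
  have hrow : ∀ i, ∫⁻ ω, ∑ j, ENNReal.ofReal (a i j ω ^ 2) ∂P ≤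
      ∑ _j : Fin n, ENNReal.ofReal ((n : ℝ)⁻¹ * K) := fun i => by
    rw [lintegral_finsetSum _ fun j _ => hm i j]
    exact Finset.sum_le_sum fun j _ => h i j
  refine (mul_le_mul_right (Finset.sum_le_sum fun i _ => hrow i) _).trans_eq ?_
  simp only [Finset.sum_const, Finset.card_univ, Fintype.card_fin, nsmul_eq_mul]
  rw [← ENNReal.ofReal_natCast n, ← ENNReal.ofReal_mul hn'.le, ← ENNReal.ofReal_mul hn'.le,
    ← ENNReal.ofReal_mul (inv_nonneg.2 hn'.le)]
  congr 1
  field_simp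

/-- For each small frequency the form is asymptotically a nondegenerate Gaussian; Fatou's lemma in
the frequency variable carries the pointwise lower bound over to the average. -/
theorem liminf_lintegral_form_pos [IsProbabilityMeasure P] (hindep : iIndepFun X P)
    (hident : ∀ k, IdentDistrib (X k) (X 0) P P) (hmeas : ∀ k, Measurable (X k))
    (hmean : ∫ ω, X 0 ω ∂P = 0) (hvar : ∫ ω, X 0 ω ^ 2 ∂P = 1)
    {c : ℤ → ℝ} {c₁ : ℝ} (hc₁ : 1 ≤ c₁) (hc : ∀ k, 0 < k → c k = c₁) (hc2 : ∀ k, |c k| ≤ 2)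
    (m : ℕ) (R : ℝ) :
    0 < liminf (fun n : ℕ => ∫⁻ ω, (∫⁻ θ in Set.Ioc 0 (2 * Real.pi), ENNReal.ofReal
      (|∑ l ∈ Finset.Icc (-((n : ℤ) + m)) (n + m), waveCoeff c m n θ l * X l ω| - R)) ∂P)
      atTop := by
  have hjoint : ∀ n : ℕ, Measurable fun p : ℝ × Ω => ENNReal.ofReal
      (|∑ l ∈ Finset.Icc (-((n : ℤ) + m)) (n + m), waveCoeff c m n p.1 l * X l p.2| - R) := by
    intro n
    have : Measurable fun p : ℝ × Ω =>
        ∑ l ∈ Finset.Icc (-((n : ℤ) + m)) (n + m), waveCoeff c m n p.1 l * X l p.2 :=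
      Finset.measurable_fun_sum _ fun l _ =>
        ((continuous_waveCoeff c m n l).measurable.comp measurable_fst).mul
          ((hmeas l).comp measurable_snd)
    fun_prop
  have hswap : ∀ n : ℕ, ∫⁻ ω, (∫⁻ θ in Set.Ioc 0 (2 * Real.pi), ENNReal.ofReal
      (|∑ l ∈ Finset.Icc (-((n : ℤ) + m)) (n + m), waveCoeff c m n θ l * X l ω| - R)) ∂P =
      ∫⁻ θ in Set.Ioc 0 (2 * Real.pi), (∫⁻ ω, ENNReal.ofReal
      (|∑ l ∈ Finset.Icc (-((n : ℤ) + m)) (n + m), waveCoeff c m n θ l * X l ω| - R) ∂P) := by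
    intro n
    rw [lintegral_lintegral_swap]
    exact ((hjoint n).comp measurable_swap).aemeasurable
  simp_rw [hswap]
  have hin : ∀ n : ℕ, Measurable fun θ : ℝ => ∫⁻ ω, ENNReal.ofReal
      (|∑ l ∈ Finset.Icc (-((n : ℤ) + m)) (n + m), waveCoeff c m n θ l * X l ω| - R) ∂P :=
    fun n => (hjoint n).lintegral_prod_right'
  refine lt_of_lt_of_le ?_ (lintegral_liminf_le hin)
  rw [lintegral_pos_iff_support (Measurable.liminf hin)]
  have hδ : (0 : ℝ) < 1 / (m + 1) := by positivity
  have hδ1 : (1 : ℝ) / (m + 1) ≤ 1 := by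
    rw [div_le_one (by positivity)]; linarith [m.cast_nonneg (α := ℝ)]
  have hsub : Set.Ioc (0 : ℝ) (1 / (m + 1)) ⊆ Set.Ioc 0 (2 * Real.pi) :=
    Set.Ioc_subset_Ioc_right (by linarith [Real.two_le_pi])
  refine lt_of_lt_of_le ?_ (measure_mono (s := Set.Ioc (0 : ℝ) (1 / (m + 1))) ?_)
  · rw [Measure.restrict_apply measurableSet_Ioc, Set.inter_eq_left.2 hsub, Real.volume_Ioc]
    simpa using hδ
  · intro θ hθ
    rw [Function.mem_support]
    have hcos : Real.cos θ < 1 := by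
      have := Real.cos_lt_cos_of_nonneg_of_le_pi le_rfl
        (by linarith [hθ.2, Real.two_le_pi]) hθ.1
      simpa using this
    exact (exists_pos_le_lintegral_excess hindep hident hmean hvar
      (fun n : ℕ => Finset.Icc (-((n : ℤ) + m)) (n + m)) (fun n l => waveCoeff c m n θ l)
      (c := (1 - Real.cos θ) / 256) (by linarith)
      (eventually_le_sum_waveCoeff_sq hc₁ hc m hθ.1 hθ.2)
      (fun ε hε => (eventually_abs_waveCoeff_le hc2 m θ hε).mono fun n h l _ => h l) R).ne'

/-- Upper bound for the expected excess of the forms at plane waves, when the limiting spectral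
distribution lives on `[-R, R]`: only the part of the spectrum beyond `R + M` contributes, and the
second moment controls it. -/
theorem liminf_lintegral_form_le [IsProbabilityMeasure P] (m : ℕ) (hmeas : ∀ k, Measurable (X k))
    (hsq : ∀ k, ∫⁻ ω, ENNReal.ofReal (X k ω ^ 2) ∂P = 1)
    {c : ℤ → ℝ} (A : (n : ℕ) → Ω → Matrix (Fin n) (Fin n) ℝ) (hA : ∀ n ω, (A n ω).IsHermitian)
    (hentry : ∀ n i j, ∃ k, ∀ ω, A n ω i j = movingSum m (fun l => X l ω) k / √n)
    (hform : ∀ (n : ℕ) ω θ, |∑ l ∈ Finset.Icc (-((n : ℤ) + m)) (n + m), waveCoeff c m n θ l * X l ω| ≤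
      ∑ k, |(hA n ω).eigenvalues k| * waveWeight (hA n ω) k θ)
    {L : Measure ℝ} (hL : IsAlmostSureLSD P A hA L) {R : ℝ} (hR : 0 ≤ R)
    (hsupp : ∀ᵐ x ∂L, |x| ≤ R) {M : ℝ} (hM : 0 < M) :
    liminf (fun n : ℕ => ∫⁻ ω, (∫⁻ θ in Set.Ioc 0 (2 * Real.pi), ENNReal.ofReal
      (|∑ l ∈ Finset.Icc (-((n : ℤ) + m)) (n + m), waveCoeff c m n θ l * X l ω| - R)) ∂P)
      atTop ≤ ENNReal.ofReal (2 * Real.pi * M⁻¹ * (2 * m + 1) ^ 2) := by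
  have hpi : (0 : ℝ) < 2 * Real.pi := by positivity
  set y : ℕ → Ω → ℝ≥0∞ := fun n ω => ∫⁻ θ in Set.Ioc 0 (2 * Real.pi), ENNReal.ofReal
      (|∑ l ∈ Finset.Icc (-((n : ℤ) + m)) (n + m), waveCoeff c m n θ l * X l ω| - R) with hy
  set s : ℕ → Ω → ℝ≥0∞ := fun n ω => ENNReal.ofReal (2 * Real.pi * M⁻¹) *
    ENNReal.ofReal ((n : ℝ)⁻¹ * ∑ i, ∑ j, A n ω i j ^ 2) with hs
  set B : ℕ → Ω → ℝ := fun n ω => ∫ x, truncExcess 1 R M x ∂(esd (A n ω) (hA n ω)) with hB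
  have hym : ∀ n, Measurable (y n) := by
    intro n
    have : Measurable fun p : Ω × ℝ =>
        ∑ l ∈ Finset.Icc (-((n : ℤ) + m)) (n + m), waveCoeff c m n p.2 l * X l p.1 :=
      Finset.measurable_fun_sum _ fun l _ =>
        ((continuous_waveCoeff c m n l).measurable.comp measurable_snd).mul
          ((hmeas l).comp measurable_fst)
    have h2 : Measurable fun p : Ω × ℝ => ENNReal.ofReal
        (|∑ l ∈ Finset.Icc (-((n : ℤ) + m)) (n + m), waveCoeff c m n p.2 l * X l p.1| - R) := by
      fun_prop
    exact h2.lintegral_prod_right'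
  have hAm : ∀ n i j, Measurable fun ω => A n ω i j := by
    intro n i j
    obtain ⟨k, hk⟩ := hentry n i j
    simp_rw [hk, movingSum]
    fun_prop
  have hsm : ∀ n, Measurable (s n) := by
    intro n
    fun_prop
  have hle : ∀ n, 0 < n → ∀ ω, y n ω ≤ ENNReal.ofReal (2 * Real.pi * B n ω) + s n ω := by
    intro n hn ω
    refine (lintegral_excess_le_sum_eigenvalues (hA n ω) hn (hform n ω) R).trans ?_
    have hsn : s n ω = ENNReal.ofReal (2 * Real.pi * M⁻¹ *
        ((n : ℝ)⁻¹ * ∑ i, ∑ j, A n ω i j ^ 2)) :=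
      (ENNReal.ofReal_mul (by positivity)).symm
    rw [hsn]
    refine le_trans (ENNReal.ofReal_le_ofReal ?_) ENNReal.ofReal_add_le
    have h := mul_le_mul_of_nonneg_left (sum_excess_le (hA n ω) hM hR) hpi.le
    calc 2 * Real.pi / n * ∑ k, max 0 (|(hA n ω).eigenvalues k| - R)
        = 2 * Real.pi * ((n : ℝ)⁻¹ * ∑ k, max 0 (|(hA n ω).eigenvalues k| - R)) := by ring
      _ ≤ _ := h.trans_eq (by ring)
  have hBM : ∀ n, 0 < n → ∀ ω, B n ω ≤ M := by
    intro n hn ω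
    rw [hB]
    dsimp only
    rw [integral_esd, inv_mul_le_iff₀ (by positivity)]
    refine (Finset.sum_le_card_nsmul _ _ M fun k _ => ?_).trans_eq (by simp)
    exact max_le hM.le (min_le_right _ _)
  have hB0 : ∀ᵐ ω ∂P, Tendsto (fun n => B n ω) atTop (𝓝 0) := by
    have hz : ∫ x, truncExcess 1 R M x ∂L = 0 := by
      refine integral_eq_zero_of_ae (hsupp.mono fun x hx => ?_)
      rw [truncExcess_apply, one_mul]
      exact max_eq_left ((min_le_left _ _).trans (by linarith))
    filter_upwards [hL] with ω hω
    simpa [hz] using hω (truncExcess 1 R M)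
  -- Only `y` and `s` are known to be measurable in `ω`, not the spectral integral `B`: dominated
  -- convergence is therefore applied to the truncated difference `y - s ≤ 2 π B`.
  have hD : Tendsto (fun n => ∫⁻ ω, (y n ω - s n ω) ∂P) atTop (𝓝 0) := by
    have hdom : ∀ᶠ n in atTop, ∀ᵐ ω ∂P, y n ω - s n ω ≤ ENNReal.ofReal (2 * Real.pi * M) := by
      filter_upwards [eventually_gt_atTop 0] with n hn
      refine Eventually.of_forall fun ω => tsub_le_iff_right.2 ((hle n hn ω).trans ?_)
      gcongr
      exact hBM n hn ω
    have := tendsto_lintegral_filter_of_dominated_convergence (μ := P) (l := atTop)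
      (F := fun n ω => y n ω - s n ω) (f := fun _ => 0)
      (fun _ => ENNReal.ofReal (2 * Real.pi * M))
      (Eventually.of_forall fun n => (hym n).sub (hsm n)) hdom (by simp) (by
        filter_upwards [hB0] with ω hω
        have h0 : Tendsto (fun n => ENNReal.ofReal (2 * Real.pi * B n ω)) atTop (𝓝 0) := by
          simpa using ENNReal.tendsto_ofReal (hω.const_mul (2 * Real.pi))
        refine tendsto_of_tendsto_of_tendsto_of_le_of_le' tendsto_const_nhds h0
          (Eventually.of_forall fun _ => zero_le) ?_
        filter_upwards [eventually_gt_atTop 0] with n hn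
        exact tsub_le_iff_right.2 (hle n hn ω))
    simpa using this
  have hS : ∀ n, 0 < n →
      ∫⁻ ω, s n ω ∂P ≤ ENNReal.ofReal (2 * Real.pi * M⁻¹ * (2 * m + 1) ^ 2) := by
    intro n hn
    have hn' : (0 : ℝ) < n := by exact_mod_cast hn
    rw [hs]
    dsimp only
    rw [lintegral_const_mul' _ _ ENNReal.ofReal_ne_top,
      ENNReal.ofReal_mul (q := (2 * (m : ℝ) + 1) ^ 2) (by positivity)]
    gcongr
    have hij : ∀ i j, ∫⁻ ω, ENNReal.ofReal (A n ω i j ^ 2) ∂P ≤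
        ENNReal.ofReal ((n : ℝ)⁻¹ * (2 * m + 1) ^ 2) := by
      intro i j
      obtain ⟨k, hk⟩ := hentry n i j
      simp_rw [hk, div_pow, Real.sq_sqrt hn'.le, div_eq_inv_mul,
        ENNReal.ofReal_mul (inv_nonneg.2 hn'.le)]
      rw [lintegral_const_mul' _ _ ENNReal.ofReal_ne_top]
      gcongr
      exact lintegral_movingSum_sq_le m hmeas hsq k
    exact lintegral_ofReal_mean_sq_le hn (hAm n) hij
  have hfin : ∀ᶠ n in atTop, ∫⁻ ω, y n ω ∂P ≤
      ∫⁻ ω, (y n ω - s n ω) ∂P + ENNReal.ofReal (2 * Real.pi * M⁻¹ * (2 * m + 1) ^ 2) := by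
    filter_upwards [eventually_gt_atTop 0] with n hn
    refine (lintegral_mono fun ω => (le_tsub_add : y n ω ≤ (y n ω - s n ω) + s n ω)).trans ?_
    rw [lintegral_add_right _ (hsm n)]
    gcongr
    exact hS n hn
  refine (liminf_le_liminf hfin).trans_eq ?_
  have := (hD.add_const (ENNReal.ofReal (2 * Real.pi * M⁻¹ * (2 * m + 1) ^ 2))).liminf_eq
  simpa using this

/-- The support is unbounded for any Hermitian ensemble built from the moving sums whose spectrum
dominates, in the weighted sense of `hform`, a linear form in the variables with the coefficients
`waveCoeff`. -/
theorem not_isBounded_support_of_form [IsProbabilityMeasure P] (m : ℕ) (hindep : iIndepFun X P)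
    (hident : ∀ k, IdentDistrib (X k) (X 0) P P) (hmeas : ∀ k, Measurable (X k))
    (hL2 : MemLp (X 0) 2 P) (hmean : ∫ ω, X 0 ω ∂P = 0) (hvar : variance (X 0) P = 1)
    {c : ℤ → ℝ} {c₁ : ℝ} (hc₁ : 1 ≤ c₁) (hc : ∀ k, 0 < k → c k = c₁) (hc2 : ∀ k, |c k| ≤ 2)
    (A : (n : ℕ) → Ω → Matrix (Fin n) (Fin n) ℝ) (hA : ∀ n ω, (A n ω).IsHermitian)
    (hentry : ∀ n i j, ∃ k, ∀ ω, A n ω i j = movingSum m (fun l => X l ω) k / √n)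
    (hform : ∀ (n : ℕ) ω θ, |∑ l ∈ Finset.Icc (-((n : ℤ) + m)) (n + m), waveCoeff c m n θ l * X l ω| ≤
      ∑ k, |(hA n ω).eigenvalues k| * waveWeight (hA n ω) k θ)
    {L : Measure ℝ} (hL : IsAlmostSureLSD P A hA L) : ¬ Bornology.IsBounded L.support := by
  intro hb
  have hvar' : ∫ ω, X 0 ω ^ 2 ∂P = 1 := by
    rw [← hvar, variance_of_integral_eq_zero (hmeas 0).aemeasurable hmean]
  have hsq : ∀ k, ∫⁻ ω, ENNReal.ofReal (X k ω ^ 2) ∂P = 1 := by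
    intro k
    have hid := (hident k).comp (u := fun x : ℝ => ENNReal.ofReal (x ^ 2)) (by fun_prop)
    have h := hid.lintegral_eq
    simp only [Function.comp_def] at h
    rw [h, ← ofReal_integral_eq_lintegral_ofReal hL2.integrable_sq
      (Eventually.of_forall fun ω => sq_nonneg _), hvar', ENNReal.ofReal_one]
  obtain ⟨r, hr⟩ := hb.subset_closedBall 0
  have hsupp : ∀ᵐ x ∂L, |x| ≤ max r 0 := by
    filter_upwards [Measure.support_mem_ae (μ := L)] with x hx
    have := hr hx
    rw [mem_closedBall_zero_iff, Real.norm_eq_abs] at this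
    exact this.trans (le_max_left _ _)
  have hpos := liminf_lintegral_form_pos hindep hident hmeas hmean hvar' hc₁ hc hc2 m (max r 0)
  have hlim : Tendsto (fun M : ℝ => ENNReal.ofReal (2 * Real.pi * M⁻¹ * (2 * m + 1) ^ 2)) atTop
      (𝓝 0) := by
    have := ENNReal.tendsto_ofReal ((tendsto_inv_atTop_zero (𝕜 := ℝ)).const_mul
      (2 * Real.pi) |>.mul_const (((2 : ℝ) * m + 1) ^ 2))
    simpa using this
  refine hpos.not_ge (ge_of_tendsto hlim ?_)
  filter_upwards [eventually_gt_atTop 0] with M hM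
  exact liminf_lintegral_form_le m hmeas hsq A hA hentry hform hL (le_max_right _ _) hsupp hM

end Support

theorem not_isBounded_support_toeplitzMA {Ω : Type*} [MeasurableSpace Ω] {P : Measure Ω}
    [IsProbabilityMeasure P] {X : ℤ → Ω → ℝ} (m : ℕ) (hindep : iIndepFun X P)
    (hident : ∀ k, IdentDistrib (X k) (X 0) P P) (hmeas : ∀ k, Measurable (X k))
    (hL2 : MemLp (X 0) 2 P) (hmean : ∫ ω, X 0 ω ∂P = 0) (hvar : variance (X 0) P = 1)
    {L : Measure ℝ} (hL : IsAlmostSureLSD P (fun n ω => toeplitzMA m n fun k => X k ω)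
      (fun n ω => toeplitzMA_isHermitian m n fun k => X k ω) L) :
    ¬ Bornology.IsBounded L.support := by
  refine not_isBounded_support_of_form m hindep hident hmeas hL2 hmean hvar (c := toeplitzMult)
    (c₁ := 2) one_le_two ?_ ?_ _ _ ?_ ?_ hL
  · intro k hk
    rw [toeplitzMult, if_neg (by omega), if_neg (by omega)]
  · intro k
    unfold toeplitzMult
    split_ifs <;> norm_num
  · exact fun n i j => ⟨_, fun ω => rfl⟩
  · intro n ω θ
    rw [sum_waveCoeff_mul, ← sum_symToeplitz_mul_cos]
    exact abs_sum_mul_cos_sub_le (toeplitzMA_isHermitian m n fun k => X k ω) θ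

theorem not_isBounded_support_hankelMA {Ω : Type*} [MeasurableSpace Ω] {P : Measure Ω}
    [IsProbabilityMeasure P] {X : ℤ → Ω → ℝ} (m : ℕ) (hindep : iIndepFun X P)
    (hident : ∀ k, IdentDistrib (X k) (X 0) P P) (hmeas : ∀ k, Measurable (X k))
    (hL2 : MemLp (X 0) 2 P) (hmean : ∫ ω, X 0 ω ∂P = 0) (hvar : variance (X 0) P = 1)
    {L : Measure ℝ} (hL : IsAlmostSureLSD P (fun n ω => hankelMA m n fun k => X k ω)
      (fun n ω => hankelMA_isHermitian m n fun k => X k ω) L) :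
    ¬ Bornology.IsBounded L.support := by
  refine not_isBounded_support_of_form m hindep hident hmeas hL2 hmean hvar (c := fun _ => 1)
    (c₁ := 1) le_rfl (fun _ _ => rfl) (fun _ => by norm_num) _ _ ?_ ?_ hL
  · exact fun n i j => ⟨_, fun ω => rfl⟩
  · intro n ω θ
    rw [sum_waveCoeff_mul, ← sum_hankel_mul_cos]
    exact abs_sum_mul_cos_rev_sub_le (hankelMA_isHermitian m n fun k => X k ω) θ

theorem theorem1p3 (m : ℕ) {Ω : Type*} [MeasurableSpace Ω] (P : Measure Ω)
    [IsProbabilityMeasure P] (X : ℤ → Ω → ℝ)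
    (hindep : iIndepFun X P) (hident : ∀ k, IdentDistrib (X k) (X 0) P P)
    (hL2 : MemLp (X 0) 2 P) (hmean : ∫ ω, X 0 ω ∂P = 0) (hvar : variance (X 0) P = 1) :
    (∀ L : Measure ℝ, IsProbabilityMeasure L →
      IsAlmostSureLSD P (fun n ω => toeplitzMA m n fun k => X k ω)
        (fun n ω => toeplitzMA_isHermitian m n fun k => X k ω) L →
      ¬ Bornology.IsBounded L.support) ∧
    (∀ L : Measure ℝ, IsProbabilityMeasure L →
      IsAlmostSureLSD P (fun n ω => hankelMA m n fun k => X k ω)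
        (fun n ω => hankelMA_isHermitian m n fun k => X k ω) L →
      ¬ Bornology.IsBounded L.support) := by
  -- Fubini's theorem needs jointly measurable forms, so pass to measurable modifications.
  have hae : ∀ k, AEMeasurable (X k) P := fun k => (hident k).aemeasurable_fst
  set Z : ℤ → Ω → ℝ := fun k => (hae k).mk (X k) with hZ
  have hXZ : ∀ k, X k =ᵐ[P] Z k := fun k => (hae k).ae_eq_mk
  have hZm : ∀ k, Measurable (Z k) := fun k => (hae k).measurable_mk
  have hZi : iIndepFun Z P := hindep.congr hXZ
  have hZd : ∀ k, IdentDistrib (Z k) (Z 0) P P := fun k =>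
    ((IdentDistrib.of_ae_eq (hae k) (hXZ k)).symm.trans (hident k)).trans
      (IdentDistrib.of_ae_eq (hae 0) (hXZ 0))
  have hZ2 : MemLp (Z 0) 2 P := hL2.ae_eq (hXZ 0)
  have hZmean : ∫ ω, Z 0 ω ∂P = 0 := by rw [← integral_congr_ae (hXZ 0), hmean]
  have hZvar : variance (Z 0) P = 1 := by rw [← variance_congr (hXZ 0), hvar]
  have hfun : ∀ᵐ ω ∂P, (fun k => X k ω) = fun k => Z k ω := by
    filter_upwards [ae_all_iff.2 hXZ] with ω hω
    exact funext hω
  refine ⟨fun L _ hL => not_isBounded_support_toeplitzMA m hZi hZd hZm hZ2 hZmean hZvar ?_,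
    fun L _ hL => not_isBounded_support_hankelMA m hZi hZd hZm hZ2 hZmean hZvar ?_⟩
  · have hesd : ∀ (n : ℕ) {x z : ℤ → ℝ}, x = z →
        esd (toeplitzMA m n x) (toeplitzMA_isHermitian m n x) =
          esd (toeplitzMA m n z) (toeplitzMA_isHermitian m n z) := by
      rintro n x _ rfl; rfl
    filter_upwards [hL, hfun] with ω h1 h2 f
    simpa only [hesd _ h2] using h1 f
  · have hesd : ∀ (n : ℕ) {x z : ℤ → ℝ}, x = z →
        esd (hankelMA m n x) (hankelMA_isHermitian m n x) =
          esd (hankelMA m n z) (hankelMA_isHermitian m n z) := by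
      rintro n x _ rfl; rfl
    filter_upwards [hL, hfun] with ω h1 h2 f
    simpa only [hesd _ h2] using h1 f
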